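/- There is an absolute constant $C>0$ such that the following holds for every fixed $\epsilon>0$. For a prime $p$ ($\log$ is the natural logarithm), let $$R=\{r : r \text{ prime},\ (\log p)^{1+\epsilon}/2<r\le(\log p)^{1+\epsilon}\},\qquad S=\{1,2,\dots,\lfloor(\log p)^{1+2\epsilon}\rfloor\},$$ $$T=\{\,s\cdot r^{-1} \bmod p : r\in R,\ s\in S\,\}\subseteq\{0,\dots,p-1\},$$ where $r^{-1}$ is the inverse modulo $p$. Let $L_p=\{a^i : p \text{ divides } i\}$. A (measure-once, one-way) quantum finite automaton (QFA) has a finite set of states $Q$, split into accepting and rejecting states, a starting state $q_0$, and for each letter and each of two endmarkers a unitary transformation of $\mathbb{C}^Q$. On a word $x$ it starts in $|q_0\rangle$, applies the transformations of the left endmarker, of the letters of $x$ in order and of the right endmarker, and then measures; the acceptance probability is the squared norm of the projection of the final superposition to the span of the accepting states. For $k_1,\dots,k_d$ with $d\ge1$, let $U=U(k_1,\dots,k_d)$ be a QFA with the $2d$ states $q_{i,0},q_{i,1}$ ($1\le i\le d$), starting state and only accepting state $q_{1,0}$, such that the left endmarker maps $|q_{1,0}\rangle$ to $\frac1{\sqrt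 d}\sum_i|q_{i,0}\rangle$; the letter $a$ maps $|q_{i,0}\rangle$ to $\cos\frac{2\pi k_i}{p}|q_{i,0}\rangle+\sin\frac{2\pi k_i}{p}|q_{i,1}\rangle$ and $|q_{i,1}\rangle$ to $-\sin\frac{2\pi k_i}{p}|q_{i,0}\rangle+\cos\frac{2\pi k_i}{p}|q_{i,1}\rangle$; and the right endmarker fixes each $|q_{i,1}\rangle$ and maps each $|q_{i,0}\rangle$ to $\frac1{\sqrt d}|q_{1,0}\rangle$ plus a combination of other basis states. (1) For every prime $p$ with $(\log p)^{1+\epsilon}<p$ (so that all $r\in R$ are invertible modulo $p$) and every listing $k_1,\dots,k_d$, $d\ge1$, of the elements of $T$ without repetition, such a QFA $U$ exists, and every such $U$ has at most $C(\log p)^{2+3\epsilon}$ states and accepts every word of $L_p$ with probability $1$. (2) For all sufficiently large primes $p$ (depending on $\epsilon$), $(\log p)^{1+\epsilon}<p$, $T$ is nonempty, and every such $U$ accepts every word $a^j\notin L_p$ with probability at most $C(\log p)^{-2\epsilon}$. (3) In particular the error probability on words not in $L_p$ tends to $0$: for every $\eta>0$, for all sufficiently large primes $p$, every such $U$ accepts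 every word $a^j\notin L_p$ with probability at most $\eta$. -/

import Mathlib

open Filter

/-- The working alphabet of a quantum automaton over `A`: the letters of `A` together with a left
and a right endmarker. -/
inductive WorkSym (A : Type) : Type where
  | left : WorkSym A
  | letter : A → WorkSym A
  | right : WorkSym A

/-- A measure-once one-way quantum finite automaton with input alphabet `A` and finite state set `Q`.
`δ q₁ a q₂` is the amplitude of `q₂` after reading `a` in state `q₁`. -/
structure QFA (A Q : Type) [Fintype Q] [DecidableEq Q] where
  δ : Q → WorkSym A → Q → ℂ
  start : Q
  acc : Finset Q
  rej : Finset Q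
  acc_union_rej : acc ∪ rej = Finset.univ
  acc_disjoint_rej : Disjoint acc rej
  unitary : ∀ a : WorkSym A,
    (Matrix.of fun q₂ q₁ => δ q₁ a q₂) ∈ Matrix.unitaryGroup Q ℂ

namespace QFA

variable {A Q : Type} [Fintype Q] [DecidableEq Q]

/-- The number of states. -/
def numStates (_M : QFA A Q) : ℕ := Fintype.card Q

/-- The transformation `V_a`, with `V_a |q₁⟩ = ∑ q₂, δ(q₁, a, q₂) |q₂⟩`. -/
def V (M : QFA A Q) (a : WorkSym A) : Matrix Q Q ℂ :=
  Matrix.of fun q₂ q₁ => M.δ q₁ a q₂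

/-- The superposition reached from `|start⟩` after reading the left endmarker, the word `w` and the
right endmarker. -/
def finalState (M : QFA A Q) (w : List A) : Q → ℂ :=
  (WorkSym.left :: (w.map WorkSym.letter ++ [WorkSym.right])).foldl
    (fun ψ a => (M.V a).mulVec ψ) (Pi.single M.start 1)

/-- The probability that the final observation finds an accepting state. -/
noncomputable def acceptProb (M : QFA A Q) (w : List A) : ℝ :=
  ∑ q ∈ M.acc, ‖M.finalState w q‖ ^ 2

end QFA

/-- The language `L_p = {a^i : p ∣ i}` over the one-letter alphabet. -/
def langL (p : ℕ) : Language Unit :=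
  {w | ∃ i : ℕ, p ∣ i ∧ w = List.replicate i ()}

/-- `M` is the automaton `U` that combines the rotation automata `U_{k_1}, …, U_{k_d}`.
The state `(i, 0)` is `q_{i,0}` and `(i, 1)` is `q_{i,1}`; the first index is `0 : Fin d`.
The two endmarker transformations are fixed only as far as the construction fixes them. -/
structure IsCombined (p : ℕ) {d : ℕ} [NeZero d] (k : Fin d → ℕ)
    (M : QFA Unit (Fin d × Fin 2)) : Prop where
  start_eq : M.start = (0, 0)
  acc_eq : M.acc = {(0, 0)}
  left_start : ∀ q : Fin d × Fin 2,
    M.δ (0, 0) .left q = if q.2 = 0 then (1 / Real.sqrt d : ℝ) else (0 : ℝ)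
  letter_zero : ∀ (i : Fin d) (q : Fin d × Fin 2),
    M.δ (i, 0) (.letter ()) q =
      if q = (i, 0) then Real.cos (2 * Real.pi * k i / p)
      else if q = (i, 1) then Real.sin (2 * Real.pi * k i / p) else (0 : ℝ)
  letter_one : ∀ (i : Fin d) (q : Fin d × Fin 2),
    M.δ (i, 1) (.letter ()) q =
      if q = (i, 0) then -Real.sin (2 * Real.pi * k i / p)
      else if q = (i, 1) then Real.cos (2 * Real.pi * k i / p) else (0 : ℝ)
  right_zero : ∀ i : Fin d, M.δ (i, 0) .right (0, 0) = (1 / Real.sqrt d : ℝ)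
  right_one : ∀ (i : Fin d) (q : Fin d × Fin 2),
    M.δ (i, 1) .right q = if q = (i, 1) then 1 else 0

/-- The primes `r` with `(log p)^(1+ε) / 2 < r ≤ (log p)^(1+ε)`. -/
noncomputable def aikpsR (ε : ℝ) (p : ℕ) : Finset ℕ :=
  (Finset.Icc 1 ⌊Real.log p ^ (1 + ε)⌋₊).filter
    fun r => r.Prime ∧ Real.log p ^ (1 + ε) / 2 < r

/-- The integers `1, 2, …, ⌊(log p)^(1+2ε)⌋`. -/
noncomputable def aikpsS (ε : ℝ) (p : ℕ) : Finset ℕ :=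
  Finset.Icc 1 ⌊Real.log p ^ (1 + 2 * ε)⌋₊

/-- The set `T` of the residues `s * r⁻¹ mod p`, as numbers in `{0, …, p - 1}`. -/
noncomputable def aikpsT (ε : ℝ) (p : ℕ) : Finset ℕ :=
  Finset.image₂ (fun s r : ℕ => ((s : ZMod p) * (r : ZMod p)⁻¹).val) (aikpsS ε p) (aikpsR ε p)

/-- `k` lists the elements of `T`, each exactly once. -/
def EnumeratesT (ε : ℝ) (p : ℕ) {d : ℕ} (k : Fin d → ℕ) : Prop :=
  Function.Injective k ∧ Finset.univ.image k = aikpsT ε p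

/-- `M` is an automaton combining the `U_k`, where `k` runs over `T`. -/
def IsAIKPSAutomaton (ε : ℝ) (p : ℕ) {d : ℕ} [NeZero d] (M : QFA Unit (Fin d × Fin 2)) : Prop :=
  ∃ k : Fin d → ℕ, EnumeratesT ε p k ∧ IsCombined p k M

/-! On `a^j` the accepting amplitude is the average over `T` of cos(2πjt/p). It equals 1 when p
divides j; otherwise it must be shown to be O(L^(-ε)), where L = log p. Put x = L^(1+ε) and N =
⌊L^(1+2ε)⌋.

Fix r, let a be the minimal residue of j/r and j' that of j, and write r·a = j' + p·m, so |m| ≤ r ≤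
x. The sum over s is a Dirichlet kernel of size at most p/(2|a|), which is at most x/|m| if m ≠ 0;
for m = 0 the trivial bound N is used. All primes r sharing one m divide the nonzero integer j' +
p·m, which is at most p² in absolute value, so there are at most 2L/log(x/2) of them
(`card_quotientLift_fiber_mul_log_le`). Summing over m costs only a harmonic sum, and the total is
O(L·N/log x). Chebyshev's bound gives at least x/(24 log x) primes in `R`, so relative to all |R|·N
pairs the saving is L/x = L^(-ε).

Pairs (s, r) with r ∤ s give distinct residues because N·x < p, and the other pairs are a proportion
O(1/x). Hence the sum over pairs may replace the sum over `T`, and |T| is comparable to |R|·N. -/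

/-! ### Chebyshev's lower bound for primes in (x/2, x]. -/

/-- As in Erdős's proof of Bertrand's postulate: every prime power in the central binomial
coefficient is at most 2n, primes above √(2n) occur at most once, and those in (2n/3, n] do not
occur. The middle range is bounded by a primorial. -/
theorem centralBinom_le_mul_pow_card_primes (n : ℕ) (hn : 2 < n) :
    n.centralBinom ≤ (2 * n) ^ Nat.sqrt (2 * n) * 4 ^ (2 * n / 3) *
      (2 * n) ^ ((Finset.Ioc n (2 * n)).filter Nat.Prime).card := by
  have n2_pos : 1 ≤ 2 * n := by omega
  let f : ℕ → ℕ := fun q => q ^ n.centralBinom.factorization q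
  let S := (Finset.range (2 * n + 1)).filter Nat.Prime
  have hS : n.centralBinom = ∏ q ∈ S, f q := by
    rw [← n.prod_pow_factorization_centralBinom]
    symm
    refine Finset.prod_filter_of_ne fun q _ h => ?_
    contrapose h
    dsimp only [f]
    rw [Nat.factorization_eq_zero_of_not_prime n.centralBinom h, pow_zero]
  have hsmall : ∏ q ∈ S with q ≤ Nat.sqrt (2 * n), f q ≤ (2 * n) ^ Nat.sqrt (2 * n) := by
    refine (Finset.prod_le_prod' (g := fun _ => 2 * n) fun q _ =>
      Nat.pow_factorization_choose_le n2_pos).trans ?_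
    rw [Finset.prod_const]
    refine pow_right_mono₀ n2_pos ((Finset.card_le_card (t := Finset.Icc 1 (Nat.sqrt (2 * n)))
      fun q hq => ?_).trans (by simp))
    obtain ⟨h1, h2⟩ := Finset.mem_filter.1 hq
    exact Finset.mem_Icc.2 ⟨(Finset.mem_filter.1 h1).2.one_lt.le, h2⟩
  let B := S.filter fun q => ¬ q ≤ Nat.sqrt (2 * n)
  have hone : ∀ q, ¬ q ≤ Nat.sqrt (2 * n) → n.centralBinom.factorization q ≤ 1 := fun q hq =>
    Nat.factorization_choose_le_one (Nat.sqrt_lt'.1 (not_le.1 hq))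
  have hmid : ∏ q ∈ B.filter (· ≤ n), f q ≤
      4 ^ (2 * n / 3) := by
    refine le_trans ?_ (primorial_le_four_pow (2 * n / 3))
    have hsub : ∏ q ∈ B.filter (· ≤ n), f q =
        ∏ q ∈ (B.filter (· ≤ n)).filter (· ≤ 2 * n / 3), f q := by
      symm
      refine Finset.prod_filter_of_ne fun q hq h => ?_
      contrapose h
      simp only [B, S, Finset.mem_filter] at hq
      dsimp only [f]
      rw [Nat.factorization_centralBinom_of_two_mul_self_lt_three_mul hn hq.2 (by omega), pow_zero]
    rw [hsub, primorial]
    refine (Finset.prod_le_prod' (g := fun q => q) fun q hq => ?_).trans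
      (Finset.prod_le_prod_of_subset_of_one_le' (fun q hq => ?_) fun q hq _ => ?_)
    · simp only [B, S, Finset.mem_filter] at hq
      exact (pow_right_mono₀ hq.1.1.1.2.one_lt.le (hone q hq.1.1.2)).trans (pow_one q).le
    · simp only [B, S, Finset.mem_filter, Finset.mem_range] at hq ⊢
      exact ⟨by omega, hq.1.1.1.2⟩
    · simp only [Finset.mem_filter] at hq
      exact hq.2.one_lt.le
  have hbig : ∏ q ∈ B.filter (¬ · ≤ n), f q ≤
      (2 * n) ^ ((Finset.Ioc n (2 * n)).filter Nat.Prime).card := by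
    refine (Finset.prod_le_prod' (g := fun _ => 2 * n) fun q _ =>
      Nat.pow_factorization_choose_le n2_pos).trans ?_
    rw [Finset.prod_const]
    refine pow_right_mono₀ n2_pos (Finset.card_le_card fun q hq => ?_)
    simp only [B, S, Finset.mem_filter, Finset.mem_range, Finset.mem_Ioc] at hq ⊢
    exact ⟨by omega, hq.1.1.2⟩
  rw [hS, ← Finset.prod_filter_mul_prod_filter_not S (· ≤ Nat.sqrt (2 * n)),
    ← Finset.prod_filter_mul_prod_filter_not B (· ≤ n),
    mul_assoc]
  exact Nat.mul_le_mul hsmall (Nat.mul_le_mul hmid hbig)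

/-- With y = 2n this absorbs the small primes and the factor n in 4^n < n·`centralBinom n`. -/
theorem eventually_sqrt_add_one_mul_log_le :
    ∀ᶠ y : ℝ in atTop, (√y + 1) * Real.log y ≤ y / 24 := by
  have h1 := (isLittleO_log_rpow_atTop (show (0 : ℝ) < 1 / 2 by norm_num)).bound
    (show (0 : ℝ) < 1 / 48 by norm_num)
  filter_upwards [h1, eventually_ge_atTop 1] with y hy h1y
  have hlog := Real.log_nonneg h1y
  rw [← Real.sqrt_eq_rpow, Real.norm_of_nonneg hlog, Real.norm_of_nonneg (Real.sqrt_nonneg _)] at hy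
  have hs : 1 ≤ √y := Real.one_le_sqrt.2 h1y
  have := Real.sq_sqrt (zero_le_one.trans h1y)
  nlinarith

theorem eventually_le_card_primes_mul_log :
    ∀ᶠ n : ℕ in atTop, (n : ℝ) / 6 ≤
      ((Finset.Ioc n (2 * n)).filter Nat.Prime).card * Real.log (2 * n : ℕ) := by
  have ht : Tendsto (fun n : ℕ => ((2 * n : ℕ) : ℝ)) atTop atTop :=
    tendsto_natCast_atTop_atTop.comp (tendsto_id.const_mul_atTop' two_pos)
  filter_upwards [ht.eventually eventually_sqrt_add_one_mul_log_le, eventually_ge_atTop 4]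
    with n hn h4
  set N := ((Finset.Ioc n (2 * n)).filter Nat.Prime).card
  have hn0 : (0 : ℝ) < n := by exact_mod_cast (by omega : 0 < n)
  have h2n : (1 : ℝ) ≤ (2 * n : ℕ) := by exact_mod_cast (by omega : 1 ≤ 2 * n)
  have key : (4 : ℝ) ^ n ≤ n * ((2 * n : ℕ) ^ Nat.sqrt (2 * n) * 4 ^ (2 * n / 3) *
      (2 * n : ℕ) ^ N) := by
    exact_mod_cast (Nat.four_pow_lt_mul_centralBinom n h4).le.trans
      (Nat.mul_le_mul_left n (centralBinom_le_mul_pow_card_primes n (by omega)))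
  have hl := Real.log_le_log (by positivity) key
  have hp : (0 : ℝ) < (2 * n : ℕ) := by linarith
  rw [Real.log_mul hn0.ne' (by positivity), Real.log_mul (by positivity) (by positivity),
    Real.log_mul (by positivity) (by positivity), Real.log_pow, Real.log_pow, Real.log_pow,
    Real.log_pow] at hl
  have hlogn : Real.log n ≤ Real.log (2 * n : ℕ) :=
    Real.log_le_log hn0 (by push_cast; linarith)
  have hsq : (Nat.sqrt (2 * n) : ℝ) * Real.log (2 * n : ℕ) ≤
      √(2 * n : ℕ) * Real.log (2 * n : ℕ) :=
    mul_le_mul_of_nonneg_right Real.nat_sqrt_le_real_sqrt (Real.log_nonneg h2n)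
  have hdiv : ((2 * n / 3 : ℕ) : ℝ) ≤ 2 * n / 3 := by
    have := @Nat.cast_div_le ℝ _ _ _ (2 * n) 3
    push_cast at this
    exact this
  have hlog4 : (1 : ℝ) ≤ Real.log 4 := by
    rw [Real.le_log_iff_exp_le (by norm_num)]
    linarith [Real.exp_one_lt_d9]
  have h5 := mul_le_mul_of_nonneg_right hdiv (zero_le_one.trans hlog4)
  have h6 : (n : ℝ) / 3 ≤ n / 3 * Real.log 4 := le_mul_of_one_le_right (by positivity) hlog4
  have h7 : ((2 * n : ℕ) : ℝ) = 2 * n := by push_cast; ring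
  -- The main term is n log 4 - (2n/3) log 4 ≥ n/3; the errors are at most 2n/24.
  rw [h7] at hn hl hlogn hsq ⊢
  linarith

/-- A Chebyshev lower bound for the number of primes in a dyadic interval. -/
theorem eventually_le_card_filter_prime_mul_log :
    ∀ᶠ x : ℝ in atTop, x / 24 ≤
      ((Finset.Icc 1 ⌊x⌋₊).filter fun r : ℕ => r.Prime ∧ x / 2 < r).card * Real.log x := by
  have ht : Tendsto (fun x : ℝ => ⌊x / 2⌋₊) atTop atTop :=
    tendsto_nat_floor_atTop.comp (tendsto_id.atTop_div_const two_pos)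
  filter_upwards [ht.eventually eventually_le_card_primes_mul_log, eventually_ge_atTop 4]
    with x hx h4
  set n := ⌊x / 2⌋₊
  have hn : (n : ℝ) ≤ x / 2 := Nat.floor_le (by linarith)
  have hn' : x / 2 < n + 1 := Nat.lt_floor_add_one _
  have h1 : x / 24 ≤ (n : ℝ) / 6 := by linarith
  have hn1 : (1 : ℝ) ≤ n := by
    exact_mod_cast Nat.le_floor (by norm_num; linarith)
  refine (h1.trans hx).trans (mul_le_mul (Nat.cast_le.2 (Finset.card_le_card fun q hq => ?_))
    (Real.log_le_log ?_ ?_) (Real.log_nonneg ?_) (Nat.cast_nonneg _))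
  · simp only [Finset.mem_filter, Finset.mem_Ioc, Finset.mem_Icc] at hq ⊢
    refine ⟨⟨hq.2.one_lt.le, Nat.le_floor ?_⟩, hq.2, (Nat.floor_lt (by linarith)).1 hq.1.1⟩
    have : (q : ℝ) ≤ (2 * n : ℕ) := by exact_mod_cast hq.1.2
    push_cast at this
    linarith
  · push_cast; linarith
  · push_cast; linarith
  · push_cast; linarith

/-! ### Existence of the automaton and its acceptance probability. -/

/-- A Householder reflection exchanging a basis vector and a given real unit vector. -/
theorem exists_symm_unitary_row {Q : Type} [Fintype Q] [DecidableEq Q] (q₀ : Q) (v : Q → ℝ)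
    (hv : ∑ q, v q ^ 2 = 1) :
    ∃ H : Matrix Q Q ℝ, (∀ q q', H q q' = H q' q) ∧ (∀ q, H q₀ q = v q) ∧
      (∀ q q', q ≠ q₀ → v q = 0 → H q q' = if q' = q then 1 else 0) ∧
      (Matrix.of fun q q' => (H q q' : ℂ)) ∈ Matrix.unitaryGroup Q ℂ := by
  obtain ⟨H, h1, h2, h3, h4⟩ : ∃ H : Matrix Q Q ℝ, (∀ q q', H q q' = H q' q) ∧
      (∀ q, H q₀ q = v q) ∧
      (∀ q q', q ≠ q₀ → v q = 0 → H q q' = if q' = q then 1 else 0) ∧ H * H = 1 := by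
    by_cases hc : v q₀ = 1
    · have hz : ∀ q, q ≠ q₀ → v q = 0 := by
        intro q hq
        rw [← Finset.add_sum_erase _ _ (Finset.mem_univ q₀), hc] at hv
        have h0 : ∑ q ∈ Finset.univ.erase q₀, v q ^ 2 = 0 := by linarith
        rw [Finset.sum_eq_zero_iff_of_nonneg fun _ _ => sq_nonneg _] at h0
        exact pow_eq_zero_iff two_ne_zero |>.1 (h0 q (Finset.mem_erase.2 ⟨hq, Finset.mem_univ q⟩))
      refine ⟨1, fun q q' => ?_, fun q => ?_, fun q q' _ _ => ?_, one_mul 1⟩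
      · simp only [Matrix.one_apply, eq_comm]
      · rcases eq_or_ne q q₀ with rfl | h
        · simp [hc]
        · rw [hz q h, Matrix.one_apply_ne h.symm]
      · simp only [Matrix.one_apply, eq_comm]
    · have hc' : 1 - v q₀ ≠ 0 := fun h => hc (by linarith)
      -- The reflection in the hyperplane orthogonal to u = e - v, where e is the basis vector at
      -- `q₀`; it fixes every basis vector where u vanishes. The excluded case v = e would give u =
      -- 0.
      set u : Q → ℝ := fun q => (if q = q₀ then 1 else 0) - v q with hu
      have huu : u ⬝ᵥ u = 2 * (1 - v q₀) := by
        have : ∀ q, u q * u q = (if q = q₀ then 1 - 2 * v q₀ else 0) + v q ^ 2 := by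
          intro q
          simp only [hu]
          split_ifs with h
          · rw [h]; ring
          · ring
        rw [dotProduct, Finset.sum_congr rfl fun q _ => this q, Finset.sum_add_distrib, hv,
          Finset.sum_ite_eq' Finset.univ q₀]
        simp only [Finset.mem_univ, if_true]
        ring
      refine ⟨1 - (1 - v q₀)⁻¹ • Matrix.vecMulVec u u, fun q q' => ?_, fun q => ?_,
        fun q q' hq hvq => ?_, ?_⟩
      · simp only [Matrix.sub_apply, Matrix.smul_apply, Matrix.vecMulVec_apply, Matrix.one_apply,
          smul_eq_mul, mul_comm (u q), eq_comm]
      · simp only [Matrix.sub_apply, Matrix.smul_apply, Matrix.vecMulVec_apply, Matrix.one_apply,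
          smul_eq_mul, hu, if_true, eq_comm (a := q₀)]
        field_simp
        ring
      · simp only [Matrix.sub_apply, Matrix.smul_apply, Matrix.vecMulVec_apply, Matrix.one_apply,
          smul_eq_mul, hu, if_neg hq, hvq, sub_zero, mul_zero, zero_mul]
        simp only [eq_comm]
      · simp only [sub_mul, mul_sub, one_mul, mul_one, Matrix.smul_mul, Matrix.mul_smul,
          Matrix.vecMulVec_mul_vecMulVec, huu]
        ext q q'
        simp only [Matrix.sub_apply, Matrix.smul_apply, Matrix.vecMulVec_apply, smul_eq_mul,
          Pi.smul_apply, Matrix.one_apply]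
        field_simp
        ring
  refine ⟨H, h1, h2, h3, ?_⟩
  rw [Matrix.mem_unitaryGroup_iff]
  ext q q'
  have := congrFun (congrFun h4 q) q'
  simp only [Matrix.mul_apply] at this
  simp only [Matrix.mul_apply, Matrix.of_apply, Matrix.star_apply, RCLike.star_def,
    Complex.conj_ofReal, h1 q']
  rw [Matrix.one_apply] at this ⊢
  split_ifs at this ⊢ <;> exact_mod_cast this

/-- The amplitudes of the direct sum of plane rotations by the angles `θ i`. -/
noncomputable def rotationAmplitude {d : ℕ} (θ : Fin d → ℝ) (q₁ q₂ : Fin d × Fin 2) : ℂ :=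
  if q₁.2 = 0 then
    if q₂ = (q₁.1, 0) then Real.cos (θ q₁.1)
    else if q₂ = (q₁.1, 1) then Real.sin (θ q₁.1) else (0 : ℝ)
  else
    if q₂ = (q₁.1, 0) then -Real.sin (θ q₁.1)
    else if q₂ = (q₁.1, 1) then Real.cos (θ q₁.1) else (0 : ℝ)

theorem rotationAmplitude_mem_unitaryGroup {d : ℕ} (θ : Fin d → ℝ) :
    (Matrix.of fun q₂ q₁ => rotationAmplitude θ q₁ q₂) ∈
      Matrix.unitaryGroup (Fin d × Fin 2) ℂ := by
  rw [Matrix.mem_unitaryGroup_iff']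
  have hcs : ∀ i, (Real.cos (θ i) : ℂ) * Real.cos (θ i) + Real.sin (θ i) * Real.sin (θ i) = 1 := by
    intro i
    have := Real.cos_sq_add_sin_sq (θ i)
    rw [sq, sq] at this
    exact_mod_cast this
  ext ⟨i, a⟩ ⟨j, b⟩
  rw [Matrix.mul_apply, Fintype.sum_prod_type, Finset.sum_eq_single i]
  · have := hcs i
    rcases eq_or_ne i j with rfl | hij
    · fin_cases a <;> fin_cases b <;>
        simp [rotationAmplitude, Fin.sum_univ_two, Prod.ext_iff,
          -Complex.ofReal_cos, -Complex.ofReal_sin] <;>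
        first | ring1 | linear_combination this
    · fin_cases a <;> fin_cases b <;>
        simp [rotationAmplitude, Prod.ext_iff, hij]
  · intro l _ hl
    fin_cases a <;> simp [rotationAmplitude, Prod.ext_iff, hl]
  · simp

/-- One reflection serves both endmarkers: being symmetric, it has the uniform vector on the states
q_{i,0} as both its row and its column at the start state. It fixes each q_{i,1}, where that vector
vanishes. -/
theorem exists_isCombined (p : ℕ) {d : ℕ} [NeZero d] (k : Fin d → ℕ) :
    ∃ M : QFA Unit (Fin d × Fin 2), IsCombined p k M := by
  have hd : (0 : ℝ) < d := by exact_mod_cast Nat.pos_of_ne_zero (NeZero.ne d)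
  obtain ⟨H, hsymm, hrow, hfix, hH⟩ := exists_symm_unitary_row (Q := Fin d × Fin 2) (0, 0)
    (fun q => if q.2 = 0 then 1 / √d else 0) (by
      rw [Fintype.sum_prod_type]
      simp [hd.ne', Real.sq_sqrt hd.le])
  refine ⟨⟨fun q₁ a q₂ => match a with
    | .left => (H q₂ q₁ : ℂ)
    | .right => (H q₂ q₁ : ℂ)
    | .letter _ => rotationAmplitude (fun i => 2 * Real.pi * k i / p) q₁ q₂,
    (0, 0), {(0, 0)}, {(0, 0)}ᶜ, Finset.union_compl _, disjoint_compl_right, ?_⟩, rfl, rfl,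
    ?_, ?_, ?_, ?_, ?_⟩
  · rintro (_ | _ | _)
    · exact hH
    · exact rotationAmplitude_mem_unitaryGroup _
    · exact hH
  · intro q
    dsimp only
    rw [hsymm, hrow]
  · intro i q
    simp only [rotationAmplitude, if_true]
    split_ifs <;> rfl
  · intro i q
    simp only [rotationAmplitude, one_ne_zero, if_false]
    split_ifs <;> simp
  · intro i
    dsimp only
    rw [hrow, if_pos rfl]
  · intro i q
    dsimp only
    rw [hsymm, hfix]
    · split_ifs <;> simp
    · simp [Prod.ext_iff]
    · simp

theorem IsCombined.foldl_letters {p d : ℕ} [NeZero d] {k : Fin d → ℕ}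
    {M : QFA Unit (Fin d × Fin 2)} (h : IsCombined p k M) (j : ℕ) :
    (List.replicate j (WorkSym.letter ())).foldl (fun ψ a => (M.V a).mulVec ψ)
        ((M.V .left).mulVec (Pi.single M.start 1)) =
      fun q => ((if q.2 = 0 then Real.cos (j * (2 * Real.pi * k q.1 / p))
        else Real.sin (j * (2 * Real.pi * k q.1 / p)) : ℝ) : ℂ) * (1 / √d : ℝ) := by
  induction j with
  | zero =>
    ext q
    simp only [List.replicate_zero, List.foldl_nil, Matrix.mulVec_single_one, QFA.V, h.start_eq,
      Matrix.col_apply, Matrix.of_apply, h.left_start]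
    split_ifs <;> simp
  | succ j ih =>
    rw [List.replicate_succ', List.foldl_append, ih]
    ext ⟨i, b⟩
    simp only [List.foldl_cons, List.foldl_nil, Matrix.mulVec, dotProduct, QFA.V, Matrix.of_apply,
      Fintype.sum_prod_type, Fin.sum_univ_two, h.letter_zero, h.letter_one]
    rw [Finset.sum_eq_single i]
    · have e : ((j + 1 : ℕ) : ℝ) * (2 * Real.pi * k i / p) =
          j * (2 * Real.pi * k i / p) + 2 * Real.pi * k i / p := by push_cast; ring
      rw [e]
      generalize (j : ℝ) * (2 * Real.pi * k i / p) = α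
      generalize 2 * Real.pi * k i / p = β
      fin_cases b
      · simp [Real.cos_add, -Complex.ofReal_cos, -Complex.ofReal_sin]
        ring
      · simp [Real.sin_add, -Complex.ofReal_cos, -Complex.ofReal_sin]
        ring
    · intro l _ hl
      simp [Prod.ext_iff, hl.symm]
    · simp

/-- Each endmarker contributes a factor 1/√d. The unspecified endmarker entries play no role, since
only the start column on the left and the start row on the right enter. -/
theorem IsCombined.acceptProb_replicate {p d : ℕ} [NeZero d] {k : Fin d → ℕ}
    {M : QFA Unit (Fin d × Fin 2)} (h : IsCombined p k M) (j : ℕ) :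
    M.acceptProb (List.replicate j ()) =
      ((∑ i, Real.cos (j * (2 * Real.pi * k i / p))) / d) ^ 2 := by
  have hd : (0 : ℝ) ≤ d := Nat.cast_nonneg d
  have hfin : M.finalState (List.replicate j ()) (0, 0) =
      (((∑ i, Real.cos (j * (2 * Real.pi * k i / p))) / d : ℝ) : ℂ) := by
    rw [QFA.finalState, List.foldl_cons, List.foldl_append, List.map_replicate, h.foldl_letters]
    simp only [List.foldl_cons, List.foldl_nil, Matrix.mulVec, dotProduct, QFA.V, Matrix.of_apply,
      Fintype.sum_prod_type, Fin.sum_univ_two, h.right_zero, h.right_one, Prod.mk.injEq,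
      zero_ne_one, and_false, if_false, zero_mul, add_zero, if_true]
    rw [Finset.sum_div, Complex.ofReal_sum]
    refine Finset.sum_congr rfl fun i _ => ?_
    rw [← Complex.ofReal_mul, ← Complex.ofReal_mul, mul_left_comm, one_div, ← mul_inv,
      Real.mul_self_sqrt hd, ← div_eq_mul_inv]
  rw [QFA.acceptProb, h.acc_eq, Finset.sum_singleton, hfin, Complex.norm_real, Real.norm_eq_abs,
    sq_abs]

theorem IsCombined.acceptProb_eq_one {p d : ℕ} [NeZero d] {k : Fin d → ℕ}
    {M : QFA Unit (Fin d × Fin 2)} (h : IsCombined p k M) (hp : p ≠ 0) {w : List Unit}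
    (hw : w ∈ langL p) : M.acceptProb w = 1 := by
  obtain ⟨_, ⟨c, rfl⟩, rfl⟩ := hw
  have hp' : (p : ℝ) ≠ 0 := Nat.cast_ne_zero.2 hp
  have hc : ∀ i, Real.cos ((p * c : ℕ) * (2 * Real.pi * k i / p)) = 1 := by
    intro i
    rw [show ((p * c : ℕ) : ℝ) * (2 * Real.pi * k i / p) = (c * k i : ℕ) * (2 * Real.pi) by
      push_cast; field_simp]
    exact Real.cos_nat_mul_two_pi _
  rw [h.acceptProb_replicate, Finset.sum_congr rfl fun i _ => hc i]
  simp [NeZero.ne d]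

theorem card_aikpsT_le (ε : ℝ) {p : ℕ} (hp : 1 < p) :
    ((aikpsT ε p).card : ℝ) ≤ Real.log p ^ (2 + 3 * ε) := by
  have hL : 0 < Real.log p := Real.log_pos (by exact_mod_cast hp)
  have hR : ((aikpsR ε p).card : ℝ) ≤ Real.log p ^ (1 + ε) := by
    refine (Nat.cast_le.2 (Finset.card_filter_le _ _)).trans ?_
    rw [Nat.card_Icc, Nat.add_sub_cancel]
    exact Nat.floor_le (Real.rpow_nonneg hL.le _)
  have hS : ((aikpsS ε p).card : ℝ) ≤ Real.log p ^ (1 + 2 * ε) := by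
    rw [aikpsS, Nat.card_Icc, Nat.add_sub_cancel]
    exact Nat.floor_le (Real.rpow_nonneg hL.le _)
  have hT : ((aikpsT ε p).card : ℝ) ≤ (aikpsS ε p).card * (aikpsR ε p).card := by
    exact_mod_cast Finset.card_image₂_le _ _ _
  refine hT.trans ((mul_le_mul hS hR (Nat.cast_nonneg _) (Real.rpow_nonneg hL.le _)).trans_eq ?_)
  rw [← Real.rpow_add hL]
  ring_nf

theorem EnumeratesT.card_eq {ε : ℝ} {p d : ℕ} {k : Fin d → ℕ} (h : EnumeratesT ε p k) :
    (aikpsT ε p).card = d := by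
  rw [← h.2, Finset.card_image_of_injective _ h.1, Finset.card_fin]

theorem EnumeratesT.sum_eq {ε : ℝ} {p d : ℕ} {k : Fin d → ℕ} (h : EnumeratesT ε p k)
    (f : ℕ → ℝ) : ∑ i, f (k i) = ∑ t ∈ aikpsT ε p, f t := by
  rw [← h.2, Finset.sum_image fun _ _ _ _ hij => h.1 hij]

/-! ### Cosine sums over an interval, and primes dividing an integer. -/

theorem two_mul_sin_mul_sum_cos (α : ℝ) (N : ℕ) :
    2 * Real.sin α * ∑ s ∈ Finset.Icc 1 N, Real.cos (2 * (s * α)) =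
      Real.sin ((2 * N + 1) * α) - Real.sin α := by
  induction N with
  | zero => simp
  | succ N ih =>
    rw [Finset.sum_Icc_succ_top (by omega), mul_add, ih, Real.two_mul_sin_mul_cos]
    push_cast
    rw [show α - 2 * ((N + 1) * α) = -((2 * N + 1) * α) by ring, Real.sin_neg,
      show α + 2 * ((N + 1) * α) = (2 * (N + 1) + 1) * α by ring]
    ring

theorem abs_sin_mul_abs_sum_cos_le (α : ℝ) (N : ℕ) :
    |Real.sin α| * |∑ s ∈ Finset.Icc 1 N, Real.cos (2 * (s * α))| ≤ 1 := by
  have h := congrArg abs (two_mul_sin_mul_sum_cos α N)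
  rw [abs_mul, abs_mul, abs_two] at h
  have h1 := abs_sub (Real.sin ((2 * N + 1) * α)) (Real.sin α)
  have h2 := Real.abs_sin_le_one ((2 * N + 1) * α)
  have h3 := Real.abs_sin_le_one α
  linarith

theorem abs_sum_cos_mul_le {p : ℝ} (hp : 0 < p) (a : ℝ) (ha : |a| ≤ p / 2) (N : ℕ) :
    2 * |a| * |∑ s ∈ Finset.Icc 1 N, Real.cos (2 * Real.pi * (s * a) / p)| ≤ p := by
  have hα : |Real.pi * a / p| = Real.pi * |a| / p := by
    rw [abs_div, abs_mul, abs_of_pos Real.pi_pos, abs_of_pos hp]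
  -- Jordan's inequality needs |πa/p| ≤ π/2, which is why minimal residues are used later.
  have h1 : 2 / Real.pi * |Real.pi * a / p| ≤ |Real.sin (Real.pi * a / p)| := by
    refine Real.mul_abs_le_abs_sin ?_
    rw [hα, div_le_iff₀ hp]
    nlinarith [Real.pi_pos]
  have h2 := abs_sin_mul_abs_sum_cos_le (Real.pi * a / p) N
  have h3 : ∀ s : ℕ, 2 * ((s : ℝ) * (Real.pi * a / p)) = 2 * Real.pi * (s * a) / p := fun s => by
    ring
  simp only [h3] at h2
  rw [hα, show 2 / Real.pi * (Real.pi * |a| / p) = 2 * |a| / p by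
    have := Real.pi_pos.ne'
    field_simp] at h1
  have h4 := (mul_le_mul_of_nonneg_right h1 (abs_nonneg _)).trans h2
  rw [div_mul_eq_mul_div, div_le_one hp] at h4
  exact h4

theorem cos_two_pi_mul_div_eq_of_modEq {p : ℕ} (hp : p ≠ 0) {u v : ℤ}
    (h : (u : ZMod p) = v) :
    Real.cos (2 * Real.pi * u / p) = Real.cos (2 * Real.pi * v / p) := by
  obtain ⟨c, hc⟩ := (ZMod.intCast_eq_intCast_iff_dvd_sub u v p).1 h
  have hp' : (p : ℝ) ≠ 0 := Nat.cast_ne_zero.2 hp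
  have hv : (v : ℝ) = u + p * c := by exact_mod_cast (by linarith : v = u + p * c)
  rw [hv, show 2 * Real.pi * (u + p * c) / p = 2 * Real.pi * u / p + c * (2 * Real.pi) by
    field_simp, Real.cos_add_int_mul_two_pi]

/-- The number of primes above `y > 1` dividing a nonzero integer. -/
theorem card_mul_log_le_of_primes_dvd {F : Finset ℕ} {y : ℝ} (hy : 1 < y)
    (hF : ∀ r ∈ F, r.Prime ∧ y < r) {n : ℤ} (hn : n ≠ 0) (hdvd : ∀ r ∈ F, (r : ℤ) ∣ n) :
    F.card * Real.log y ≤ Real.log |(n : ℝ)| := by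
  have h1 : ∏ r ∈ F, r ∣ n.natAbs := Finset.prod_primes_dvd _ (fun r hr => (hF r hr).1.prime)
    fun r hr => Int.natCast_dvd.1 (hdvd r hr)
  have h2 : ((∏ r ∈ F, r : ℕ) : ℝ) ≤ |(n : ℝ)| := by
    rw [← Int.cast_abs, Int.abs_eq_natAbs, Int.cast_natCast]
    exact_mod_cast Nat.le_of_dvd (Int.natAbs_pos.2 hn) h1
  have h3 : y ^ F.card ≤ ((∏ r ∈ F, r : ℕ) : ℝ) := by
    rw [← Finset.prod_const, Nat.cast_prod]
    exact Finset.prod_le_prod (fun _ _ => by linarith) fun r hr => (hF r hr).2.le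
  rw [← Real.log_pow]
  exact Real.log_le_log (by positivity) (h3.trans h2)

/-! ### The exponential sum over pairs (s, r). -/

section ExponentialSum

variable {p : ℕ} [Fact p.Prime]

/-- The minimal residue `a` with `r * a ≡ j`. -/
noncomputable def minQuotient (p j r : ℕ) : ℤ := ((j : ZMod p) * (r : ZMod p)⁻¹).valMinAbs

/-- The integer `m` with `r * a = j' + p * m`, for the minimal residues `j'` of `j` and `a` of the
quotient `j / r`. -/
noncomputable def quotientLift (p j r : ℕ) : ℤ :=
  (r * minQuotient p j r - (j : ZMod p).valMinAbs) / p

theorem ZMod.abs_valMinAbs_le_half (a : ZMod p) : |(a.valMinAbs : ℝ)| ≤ p / 2 := by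
  have h := ZMod.natAbs_valMinAbs_le a
  have h2 : 2 * a.valMinAbs.natAbs ≤ p := by omega
  have h3 : (2 : ℝ) * a.valMinAbs.natAbs ≤ p := by exact_mod_cast h2
  rw [Nat.cast_natAbs, Int.cast_abs] at h3
  linarith

theorem mul_minQuotient {j r : ℕ} (hr : (r : ZMod p) ≠ 0) :
    r * minQuotient p j r = (j : ZMod p).valMinAbs + p * quotientLift p j r := by
  have h : (p : ℤ) ∣ r * minQuotient p j r - (j : ZMod p).valMinAbs := by
    rw [← ZMod.intCast_zmod_eq_zero_iff_dvd]
    push_cast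
    rw [minQuotient, ZMod.coe_valMinAbs]
    field_simp
    ring
  rw [quotientLift, Int.mul_ediv_cancel' h]
  ring

theorem natAbs_quotientLift_le {j r : ℕ} (hr : (r : ZMod p) ≠ 0) (hr0 : 0 < r) :
    (quotientLift p j r).natAbs ≤ r := by
  have hp : (0 : ℝ) < p := by exact_mod_cast (Fact.out : p.Prime).pos
  have h1 := mul_minQuotient (p := p) (j := j) hr
  have h2 : (r : ℝ) * minQuotient p j r = (j : ZMod p).valMinAbs + p * quotientLift p j r := by
    exact_mod_cast h1
  have h3 : (p : ℝ) * |(quotientLift p j r : ℝ)| ≤ r * (p / 2) + p / 2 := by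
    calc (p : ℝ) * |(quotientLift p j r : ℝ)|
        = |(r : ℝ) * minQuotient p j r - (j : ZMod p).valMinAbs| := by
          rw [h2, add_sub_cancel_left, abs_mul, abs_of_pos hp]
      _ ≤ |(r : ℝ) * minQuotient p j r| + |((j : ZMod p).valMinAbs : ℝ)| := abs_sub _ _
      _ ≤ _ := by
          rw [abs_mul, Nat.abs_cast]
          exact add_le_add (mul_le_mul_of_nonneg_left (ZMod.abs_valMinAbs_le_half _)
            (Nat.cast_nonneg _)) (ZMod.abs_valMinAbs_le_half _)
  have hr1 : (1 : ℝ) ≤ r := by exact_mod_cast hr0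
  have h4 : |(quotientLift p j r : ℝ)| ≤ r := by nlinarith
  rw [← Int.cast_abs, Int.abs_eq_natAbs, Int.cast_natCast] at h4
  exact_mod_cast h4

/-- Since |j'| ≤ p/2 and |m| ≥ 1, the residue j' can cancel at most half of p·m. -/
theorem mul_natAbs_quotientLift_le {j r : ℕ} (hr : (r : ZMod p) ≠ 0)
    (hm : quotientLift p j r ≠ 0) :
    (p : ℝ) * (quotientLift p j r).natAbs ≤ 2 * r * |(minQuotient p j r : ℝ)| := by
  have hp : (0 : ℝ) < p := by exact_mod_cast (Fact.out : p.Prime).pos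
  have h2 : (p : ℝ) * quotientLift p j r = r * minQuotient p j r - (j : ZMod p).valMinAbs := by
    rw [eq_sub_iff_add_eq']
    exact_mod_cast (mul_minQuotient (p := p) (j := j) hr).symm
  have h3 := congrArg abs h2
  rw [abs_mul, abs_of_pos hp] at h3
  have h4 := abs_sub ((r : ℝ) * minQuotient p j r) (j : ZMod p).valMinAbs
  have h5 := ZMod.abs_valMinAbs_le_half (j : ZMod p)
  rw [abs_mul, Nat.abs_cast] at h4
  have h6 : (1 : ℝ) ≤ |(quotientLift p j r : ℝ)| := by
    exact_mod_cast Int.one_le_abs hm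
  rw [Nat.cast_natAbs, Int.cast_abs]
  nlinarith

theorem abs_sum_cos_quotient_le {j r : ℕ} {x : ℝ} (hr : (r : ZMod p) ≠ 0) (hrx : r ≤ x) (N : ℕ) :
    |∑ s ∈ Finset.Icc 1 N,
      Real.cos (j * (2 * Real.pi * ((s : ZMod p) * (r : ZMod p)⁻¹).val / p))| ≤
      if (quotientLift p j r).natAbs = 0 then (N : ℝ) else x / (quotientLift p j r).natAbs := by
  have hp : (0 : ℝ) < p := by exact_mod_cast (Fact.out : p.Prime).pos
  split_ifs with hm
  · refine (Finset.abs_sum_le_sum_abs _ _).trans ((Finset.sum_le_sum fun s _ =>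
      Real.abs_cos_le_one _).trans ?_)
    simp
  · have hm' : quotientLift p j r ≠ 0 := fun h => hm (by rw [h]; rfl)
    have hterm : ∀ s : ℕ,
        Real.cos (j * (2 * Real.pi * ((s : ZMod p) * (r : ZMod p)⁻¹).val / p)) =
        Real.cos (2 * Real.pi * (s * (minQuotient p j r : ℝ)) / p) := by
      intro s
      have := cos_two_pi_mul_div_eq_of_modEq (Fact.out : p.Prime).ne_zero
        (u := j * ((s : ZMod p) * (r : ZMod p)⁻¹).val) (v := s * minQuotient p j r) (by
          push_cast
          rw [ZMod.natCast_zmod_val, minQuotient, ZMod.coe_valMinAbs]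
          ring)
      push_cast at this
      rw [← this]
      congr 1
      ring
    rw [Finset.sum_congr rfl fun s _ => hterm s]
    have h1 := abs_sum_cos_mul_le hp (minQuotient p j r) (ZMod.abs_valMinAbs_le_half _) N
    have h2 := mul_natAbs_quotientLift_le hr hm'
    have hm0 : (0 : ℝ) < (quotientLift p j r).natAbs := by exact_mod_cast Nat.pos_of_ne_zero hm
    set A := |∑ s ∈ Finset.Icc 1 N, Real.cos (2 * Real.pi * (s * (minQuotient p j r : ℝ)) / p)|
    have hS : 0 ≤ A := abs_nonneg _
    rw [le_div_iff₀ hm0]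
    refine le_trans ?_ hrx
    have h3 := mul_le_mul_of_nonneg_right h2 hS
    have h4 := mul_le_mul_of_nonneg_left h1 (Nat.cast_nonneg (α := ℝ) r)
    -- p·|m|·A ≤ 2r|a|·A ≤ r·p.
    refine le_of_mul_le_mul_left ?_ hp
    linarith

theorem card_quotientLift_fiber_mul_log_le {j : ℕ} (hj : ¬ p ∣ j) {R : Finset ℕ} {x : ℝ}
    (hx : 2 < x) (hxp : x < p) (hR : ∀ r ∈ R, r.Prime ∧ x / 2 < r ∧ r ≤ x) (m : ℤ) :
    (R.filter fun r => quotientLift p j r = m).card * Real.log (x / 2) ≤ 2 * Real.log p := by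
  have hp : (0 : ℝ) < p := by exact_mod_cast (Fact.out : p.Prime).pos
  have hp1 : (1 : ℝ) ≤ p := by exact_mod_cast (Fact.out : p.Prime).one_lt.le
  have hne : ∀ r ∈ R, (r : ZMod p) ≠ 0 := by
    intro r hr h
    rw [ZMod.natCast_eq_zero_iff] at h
    have h1 : (p : ℝ) ≤ r := by exact_mod_cast Nat.le_of_dvd (hR r hr).1.pos h
    linarith [(hR r hr).2.2]
  rcases (R.filter fun r => quotientLift p j r = m).eq_empty_or_nonempty with h | ⟨r₀, h₀⟩
  · rw [h]
    simpa using Real.log_nonneg hp1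
  · have hn : (j : ZMod p).valMinAbs + p * m ≠ 0 := by
      intro h
      have h' := congrArg (Int.cast : ℤ → ZMod p) h
      push_cast at h'
      rw [ZMod.natCast_self, zero_mul, add_zero, ZMod.natCast_eq_zero_iff] at h'
      exact hj h'
    have h1 := card_mul_log_le_of_primes_dvd (F := R.filter fun r => quotientLift p j r = m)
      (y := x / 2) (by linarith)
      (fun r hr => ⟨(hR r (Finset.mem_filter.1 hr).1).1, (hR r (Finset.mem_filter.1 hr).1).2.1⟩)
      hn (fun r hr => by
        obtain ⟨hr', hm⟩ := Finset.mem_filter.1 hr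
        rw [← hm, ← mul_minQuotient (hne r hr')]
        exact dvd_mul_right _ _)
    obtain ⟨hr₀, rfl⟩ := Finset.mem_filter.1 h₀
    refine h1.trans ?_
    -- One member r₀ of the fiber bounds the common multiple: it equals r₀·a, with r₀ and |a| both
    -- at most p.
    rw [← mul_minQuotient (hne r₀ hr₀), show 2 * Real.log p = Real.log ((p : ℝ) ^ 2) by
      rw [Real.log_pow]; norm_num]
    refine Real.log_le_log (abs_pos.2 ?_) ?_
    · rw [mul_minQuotient (hne r₀ hr₀)]
      exact_mod_cast hn
    · push_cast
      rw [abs_mul, Nat.abs_cast, sq]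
      have := ZMod.abs_valMinAbs_le_half ((j : ZMod p) * (r₀ : ZMod p)⁻¹)
      exact mul_le_mul ((hR r₀ hr₀).2.2.trans hxp.le) (this.trans (by linarith)) (abs_nonneg _) hp.le

/-- Grouping the primes by |m| merges the fibers of m and -m, whence 4 log p. The bounds N at |m| =
0 and x/|m| otherwise add up to N plus x times a harmonic number. -/
theorem sum_abs_sum_cos_quotient_mul_log_le {j : ℕ} (hj : ¬ p ∣ j) {R : Finset ℕ} {x : ℝ}
    (hx : 2 < x) (hxp : x < p) (hR : ∀ r ∈ R, r.Prime ∧ x / 2 < r ∧ r ≤ x) (N : ℕ) :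
    (∑ r ∈ R, |∑ s ∈ Finset.Icc 1 N,
      Real.cos (j * (2 * Real.pi * ((s : ZMod p) * (r : ZMod p)⁻¹).val / p))|) *
        Real.log (x / 2) ≤ 4 * Real.log p * (N + x * (1 + Real.log x)) := by
  have hne : ∀ r ∈ R, (r : ZMod p) ≠ 0 := by
    intro r hr h
    rw [ZMod.natCast_eq_zero_iff] at h
    have h1 : (p : ℝ) ≤ r := by exact_mod_cast Nat.le_of_dvd (hR r hr).1.pos h
    linarith [(hR r hr).2.2]
  have hx0 : 0 ≤ x := by linarith
  have hlog : 0 < Real.log (x / 2) := Real.log_pos (by linarith)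
  have hlogp : 0 ≤ Real.log p := Real.log_natCast_nonneg p
  let b : ℕ → ℝ := fun n => if n = 0 then (N : ℝ) else x / n
  have hb : ∀ n, 0 ≤ b n := by
    intro n
    dsimp only [b]
    split_ifs <;> positivity
  have hmaps : ∀ r ∈ R, (quotientLift p j r).natAbs ∈ Finset.range (⌊x⌋₊ + 1) := fun r hr =>
    Finset.mem_range.2 (Nat.lt_succ_of_le ((natAbs_quotientLift_le (hne r hr)
      (hR r hr).1.pos).trans (Nat.le_floor (hR r hr).2.2)))
  have hcard : ∀ n : ℕ, (R.filter fun r => (quotientLift p j r).natAbs = n).card *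
      Real.log (x / 2) ≤ 4 * Real.log p := by
    intro n
    have hsub : (R.filter fun r => (quotientLift p j r).natAbs = n) ⊆
        (R.filter fun r => quotientLift p j r = n) ∪ R.filter fun r => quotientLift p j r = -n := by
      intro r hr
      simp only [Finset.mem_filter, Finset.mem_union] at hr ⊢
      obtain ⟨hr, h⟩ := hr
      rcases Int.natAbs_eq_iff.1 h with h | h
      · exact Or.inl ⟨hr, h⟩
      · exact Or.inr ⟨hr, h⟩
    have h1 : ((R.filter fun r => (quotientLift p j r).natAbs = n).card : ℝ) ≤
        (R.filter fun r => quotientLift p j r = n).card +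
          (R.filter fun r => quotientLift p j r = -n).card := by
      exact_mod_cast (Finset.card_le_card hsub).trans (Finset.card_union_le _ _)
    have h2 := card_quotientLift_fiber_mul_log_le hj hx hxp hR n
    have h3 := card_quotientLift_fiber_mul_log_le hj hx hxp hR (-n)
    have h4 := mul_le_mul_of_nonneg_right h1 hlog.le
    linarith
  have hbsum : ∑ n ∈ Finset.range (⌊x⌋₊ + 1), b n ≤ N + x * (1 + Real.log x) := by
    have h1 := harmonic_floor_le_one_add_log x (by linarith)
    rw [Finset.sum_range_succ', add_comm]
    have h2 : ∑ n ∈ Finset.range ⌊x⌋₊, b (n + 1) = x * (harmonic ⌊x⌋₊ : ℚ) := by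
      rw [harmonic]
      push_cast
      rw [Finset.mul_sum]
      refine Finset.sum_congr rfl fun n _ => ?_
      simp [b, div_eq_mul_inv]
    rw [h2]
    exact add_le_add (by simp [b]) (mul_le_mul_of_nonneg_left h1 hx0)
  calc _ ≤ (∑ r ∈ R, b (quotientLift p j r).natAbs) * Real.log (x / 2) :=
        mul_le_mul_of_nonneg_right (Finset.sum_le_sum fun r hr =>
          abs_sum_cos_quotient_le (hne r hr) (hR r hr).2.2 N) hlog.le
    _ = ∑ n ∈ Finset.range (⌊x⌋₊ + 1),
        ((R.filter fun r => (quotientLift p j r).natAbs = n).card * Real.log (x / 2)) * b n := by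
        rw [← Finset.sum_fiberwise_of_maps_to hmaps, Finset.sum_mul]
        refine Finset.sum_congr rfl fun n _ => ?_
        rw [Finset.sum_congr rfl fun r hr => by rw [(Finset.mem_filter.1 hr).2],
          Finset.sum_const, nsmul_eq_mul]
        ring
    _ ≤ ∑ n ∈ Finset.range (⌊x⌋₊ + 1), 4 * Real.log p * b n :=
        Finset.sum_le_sum fun n _ => mul_le_mul_of_nonneg_right (hcard n) (hb n)
    _ ≤ _ := by
        rw [← Finset.mul_sum]
        exact mul_le_mul_of_nonneg_left hbsum (by positivity)

end ExponentialSum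

/-! ### From pairs (s, r) to the set of quotients. -/

/-- Both sums agree on the good elements; the bad ones cost their number once in the sum over `A`
and once in the leftover image. -/
theorem abs_sum_image_le {α β : Type*} [DecidableEq β] (A : Finset α)
    (bad : α → Prop) [DecidablePred bad] (g : α → β) (f : β → ℝ) (hf : ∀ t, |f t| ≤ 1)
    (hg : Set.InjOn g (A.filter fun a => ¬ bad a)) :
    |∑ t ∈ A.image g, f t| ≤ |∑ a ∈ A, f (g a)| + 2 * (A.filter bad).card := by
  have hsub : (A.filter fun a => ¬ bad a).image g ⊆ A.image g :=
    Finset.image_subset_image (Finset.filter_subset _ _)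
  have hrest : A.image g \ (A.filter fun a => ¬ bad a).image g ⊆ (A.filter bad).image g := by
    intro t ht
    simp only [Finset.mem_sdiff, Finset.mem_image, Finset.mem_filter] at ht ⊢
    obtain ⟨⟨a, ha, rfl⟩, h⟩ := ht
    exact ⟨a, ⟨ha, by_contra fun hb => h ⟨a, ⟨ha, hb⟩, rfl⟩⟩, rfl⟩
  have h1 := Finset.sum_sdiff (f := f) hsub
  rw [Finset.sum_image hg] at h1
  have h2 := Finset.sum_filter_add_sum_filter_not A bad fun a => f (g a)
  have h3 : |∑ t ∈ A.image g \ (A.filter fun a => ¬ bad a).image g, f t| ≤ (A.filter bad).card := by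
    refine (Finset.abs_sum_le_sum_abs _ _).trans ((Finset.sum_le_sum fun t _ => hf t).trans ?_)
    rw [Finset.sum_const, nsmul_eq_mul, mul_one]
    exact_mod_cast (Finset.card_le_card hrest).trans Finset.card_image_le
  have h4 : |∑ a ∈ A.filter bad, f (g a)| ≤ (A.filter bad).card := by
    refine (Finset.abs_sum_le_sum_abs _ _).trans ((Finset.sum_le_sum fun a _ => hf _).trans ?_)
    simp
  rw [← h1, show ∑ a ∈ A with ¬ bad a, f (g a) =
    ∑ a ∈ A, f (g a) - ∑ a ∈ A with bad a, f (g a) by linarith]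
  rw [abs_le] at h3 h4 ⊢
  have h5 := abs_le.1 (le_refl |∑ a ∈ A, f (g a)|)
  constructor <;> linarith

theorem card_le_card_image_add {α β : Type*} [DecidableEq β] (A : Finset α)
    (bad : α → Prop) [DecidablePred bad] (g : α → β)
    (hg : Set.InjOn g (A.filter fun a => ¬ bad a)) :
    A.card ≤ (A.image g).card + (A.filter bad).card := by
  rw [← Finset.card_filter_add_card_filter_not (s := A) bad, add_comm,
    ← Finset.card_image_of_injOn hg]
  exact Nat.add_le_add_right
    (Finset.card_le_card (Finset.image_subset_image (Finset.filter_subset _ _))) _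

/-- From s/r = s'/r' follows s·r' ≡ s'·r with both sides below p, hence equality of integers. For
distinct primes r, r' this forces r ∣ s. -/
theorem injOn_quotient {p : ℕ} [Fact p.Prime] {R : Finset ℕ} {N : ℕ}
    (hR : ∀ r ∈ R, r.Prime ∧ r < p ∧ N * r < p) :
    Set.InjOn (fun a : ℕ × ℕ => ((a.1 : ZMod p) * (a.2 : ZMod p)⁻¹).val)
      ((Finset.Icc 1 N ×ˢ R).filter fun a => ¬ a.2 ∣ a.1) := by
  have hne : ∀ r ∈ R, (r : ZMod p) ≠ 0 := by
    intro r hr h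
    rw [ZMod.natCast_eq_zero_iff] at h
    exact (Nat.le_of_dvd (hR r hr).1.pos h).not_gt (hR r hr).2.1
  rintro ⟨s, r⟩ h ⟨s', r'⟩ h' e
  simp only [Finset.coe_filter, Set.mem_ofPred_eq, Finset.mem_product, Finset.mem_Icc] at h h'
  obtain ⟨⟨hs, hr⟩, hd⟩ := h
  obtain ⟨⟨hs', hr'⟩, hd'⟩ := h'
  have e1 := ZMod.val_injective p e
  have h1 := hne r hr
  have h2 := hne r' hr'
  have e2 : ((s * r' : ℕ) : ZMod p) = ((s' * r : ℕ) : ZMod p) := by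
    push_cast
    field_simp at e1
    linear_combination e1
  rw [ZMod.natCast_eq_natCast_iff, Nat.ModEq,
    Nat.mod_eq_of_lt ((Nat.mul_le_mul_right _ hs.2).trans_lt (hR r' hr').2.2),
    Nat.mod_eq_of_lt ((Nat.mul_le_mul_right _ hs'.2).trans_lt (hR r hr).2.2)] at e2
  rcases eq_or_ne r r' with rfl | hrr
  · rw [Nat.eq_of_mul_eq_mul_right (hR r hr).1.pos e2]
  · exact absurd (((Nat.coprime_primes (hR r hr).1 (hR r' hr').1).2 hrr).dvd_of_dvd_mul_right
      (e2 ▸ dvd_mul_left r s')) hd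

theorem card_filter_dvd_mul_le {R : Finset ℕ} {x : ℝ} (hx : 0 < x) (hR : ∀ r ∈ R, x / 2 < r)
    (N : ℕ) : ((Finset.Icc 1 N ×ˢ R).filter fun a => a.2 ∣ a.1).card * x ≤ 2 * (R.card * N) := by
  have h1 : ((Finset.Icc 1 N ×ˢ R).filter fun a => a.2 ∣ a.1).card = ∑ r ∈ R, N / r := by
    rw [Finset.card_filter, Finset.sum_product_right]
    refine Finset.sum_congr rfl fun r _ => ?_
    rw [← Finset.card_filter, ← Nat.Ioc_filter_dvd_card_eq_div]
    rfl
  rw [h1]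
  push_cast
  rw [Finset.sum_mul, ← nsmul_eq_mul, ← Finset.sum_const, Finset.mul_sum]
  refine Finset.sum_le_sum fun r hr => ?_
  have h2 := hR r hr
  have hr0 : (0 : ℝ) < r := by linarith
  have h3 : ((N / r : ℕ) : ℝ) * r ≤ N := by exact_mod_cast Nat.div_mul_le_self N r
  have h4 : (0 : ℝ) ≤ (N / r : ℕ) := Nat.cast_nonneg _
  nlinarith

/-- The exponential sum over the set of quotients `s / r`. -/
theorem abs_sum_quotients_le {p j N : ℕ} (hp : p.Prime) (hj : ¬ p ∣ j) {R T : Finset ℕ} {x : ℝ}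
    (hx : 4 ≤ x) (hxp : x < p) (hNp : N * x < p) (hR : ∀ r ∈ R, r.Prime ∧ x / 2 < r ∧ r ≤ x)
    (hT : T = Finset.image₂ (fun s r : ℕ => ((s : ZMod p) * (r : ZMod p)⁻¹).val)
      (Finset.Icc 1 N) R) :
    |∑ t ∈ T, Real.cos (j * (2 * Real.pi * t / p))| ≤
      4 * Real.log p * (N + x * (1 + Real.log x)) / Real.log (x / 2) + 4 * (R.card * N) / x := by
  have : Fact p.Prime := ⟨hp⟩
  have hinj := injOn_quotient (N := N) fun r hr => ⟨(hR r hr).1,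
    by exact_mod_cast (hR r hr).2.2.trans_lt hxp, by
      exact_mod_cast (mul_le_mul_of_nonneg_left (hR r hr).2.2 (Nat.cast_nonneg N)).trans_lt hNp⟩
  have h1 := abs_sum_image_le (Finset.Icc 1 N ×ˢ R) _ _
    (fun t : ℕ => Real.cos (j * (2 * Real.pi * t / p))) (fun _ => Real.abs_cos_le_one _) hinj
  have h2 := card_filter_dvd_mul_le (by linarith) (fun r hr => (hR r hr).2.1) N
  have h3 := sum_abs_sum_cos_quotient_mul_log_le hj (by linarith) hxp hR N
  have h4 : |∑ a ∈ Finset.Icc 1 N ×ˢ R,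
      Real.cos (j * (2 * Real.pi * ((a.1 : ZMod p) * (a.2 : ZMod p)⁻¹).val / p))| ≤
      ∑ r ∈ R, |∑ s ∈ Finset.Icc 1 N,
        Real.cos (j * (2 * Real.pi * ((s : ZMod p) * (r : ZMod p)⁻¹).val / p))| := by
    rw [Finset.sum_product_right]
    exact Finset.abs_sum_le_sum_abs _ _
  rw [← le_div_iff₀ (Real.log_pos (by linarith))] at h3
  rw [← le_div_iff₀ (by linarith)] at h2
  rw [hT, ← Finset.image_uncurry_product]
  have h5 : 4 * ((R.card : ℝ) * N) / x = 2 * (2 * (R.card * N) / x) := by ring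
  rw [h5]
  refine h1.trans ?_
  linarith

/-- The pairs with r ∣ s are a proportion at most 2/x ≤ 1/2. -/
theorem card_mul_le_two_mul_card_quotients {p N : ℕ} (hp : p.Prime) {R T : Finset ℕ} {x : ℝ}
    (hx : 4 ≤ x) (hxp : x < p) (hNp : N * x < p) (hR : ∀ r ∈ R, r.Prime ∧ x / 2 < r ∧ r ≤ x)
    (hT : T = Finset.image₂ (fun s r : ℕ => ((s : ZMod p) * (r : ZMod p)⁻¹).val)
      (Finset.Icc 1 N) R) :
    (R.card * N : ℝ) ≤ 2 * T.card := by
  have : Fact p.Prime := ⟨hp⟩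
  have hinj := injOn_quotient (N := N) fun r hr => ⟨(hR r hr).1,
    by exact_mod_cast (hR r hr).2.2.trans_lt hxp, by
      exact_mod_cast (mul_le_mul_of_nonneg_left (hR r hr).2.2 (Nat.cast_nonneg N)).trans_lt hNp⟩
  have h1 := card_le_card_image_add (Finset.Icc 1 N ×ˢ R) _ _ hinj
  have h2 := card_filter_dvd_mul_le (by linarith) (fun r hr => (hR r hr).2.1) N
  have hT' : T = (Finset.Icc 1 N ×ˢ R).image
      fun a : ℕ × ℕ => ((a.1 : ZMod p) * (a.2 : ZMod p)⁻¹).val := by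
    rw [hT, ← Finset.image_uncurry_product]
    rfl
  rw [← hT', Finset.card_product, Nat.card_Icc, Nat.add_sub_cancel] at h1
  have h3 : (N * R.card : ℝ) ≤
      T.card + ((Finset.Icc 1 N ×ˢ R).filter fun a => a.2 ∣ a.1).card := by exact_mod_cast h1
  have h4 : (0 : ℝ) ≤ ((Finset.Icc 1 N ×ˢ R).filter fun a => a.2 ∣ a.1).card := Nat.cast_nonneg _
  nlinarith

/-! ### Choice of parameters and conclusion. -/

/-- The normalized exponential sum over `T`, given lower bounds on the parameters. -/
theorem abs_sum_aikpsT_le {ε : ℝ} (hε : 0 < ε) {p : ℕ} (hp : p.Prime) (hL : 1 ≤ Real.log p)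
    (hx : 4 ≤ Real.log p ^ (1 + ε))
    (hcheb : Real.log p ^ (1 + ε) / 24 ≤ (aikpsR ε p).card * Real.log (Real.log p ^ (1 + ε)))
    (hlog : 1 + Real.log (Real.log p ^ (1 + ε)) ≤ Real.log p ^ ε)
    (hTp : Real.log p ^ (2 + 3 * ε) < p) :
    Real.log p ^ (1 + ε) < p ∧ (aikpsT ε p).Nonempty ∧ ∀ j : ℕ, ¬ p ∣ j →
      |∑ t ∈ aikpsT ε p, Real.cos (j * (2 * Real.pi * t / p))| ≤
        1544 * Real.log p ^ (-ε) * (aikpsT ε p).card := by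
  set L := Real.log p
  have hL0 : 0 < L := by linarith
  set x := L ^ (1 + ε) with hxdef
  set y := L ^ (1 + 2 * ε) with hydef
  have hxy : x * L ^ ε = y := by rw [hxdef, hydef, ← Real.rpow_add hL0]; ring_nf
  have hyx : y * x = L ^ (2 + 3 * ε) := by rw [hxdef, hydef, ← Real.rpow_add hL0]; ring_nf
  have hxL : x * L ^ (-ε) = L := by
    rw [hxdef, ← Real.rpow_add hL0, show 1 + ε + -ε = 1 by ring, Real.rpow_one]
  have hLε : 1 ≤ L ^ ε := Real.one_le_rpow hL hε.le
  have hy4 : 4 ≤ y := by nlinarith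
  have hxp : x < p := lt_of_le_of_lt (by nlinarith) hTp
  set N := ⌊y⌋₊
  have hNy : (N : ℝ) ≤ y := Nat.floor_le (by linarith)
  have hNy' : y / 2 ≤ N := by linarith [Nat.lt_floor_add_one y]
  have hNp : N * x < p := lt_of_le_of_lt (by nlinarith) hTp
  have hR : ∀ r ∈ aikpsR ε p, r.Prime ∧ x / 2 < r ∧ r ≤ x := by
    intro r hr
    simp only [aikpsR, Finset.mem_filter, Finset.mem_Icc] at hr
    exact ⟨hr.2.1, hr.2.2, (Nat.le_floor_iff (by linarith)).1 hr.1.2⟩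
  have hT : aikpsT ε p = Finset.image₂
      (fun s r : ℕ => ((s : ZMod p) * (r : ZMod p)⁻¹).val) (Finset.Icc 1 N) (aikpsR ε p) := rfl
  set n : ℝ := ((aikpsR ε p).card : ℝ)
  set c : ℝ := ((aikpsT ε p).card : ℝ)
  have hlogx : 0 < Real.log x := Real.log_pos (by linarith)
  have hn : 0 < n :=
    pos_of_mul_pos_left (lt_of_lt_of_le (by positivity) hcheb) hlogx.le
  have hcard := card_mul_le_two_mul_card_quotients hp hx hxp hNp hR hT
  have hnN : n * y / 4 ≤ c := by nlinarith
  have hc0 : 0 < c := lt_of_lt_of_le (by positivity) hnN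
  refine ⟨hxp, Finset.card_pos.1 (Nat.cast_pos.1 hc0), fun j hj => ?_⟩
  have hhalf : Real.log x / 2 ≤ Real.log (x / 2) := by
    rw [Real.log_div (by linarith) two_ne_zero]
    have h4 : Real.log 4 ≤ Real.log x := Real.log_le_log (by norm_num) hx
    rw [show (4 : ℝ) = 2 ^ 2 by norm_num, Real.log_pow] at h4
    push_cast at h4
    linarith
  -- The saving L^(-ε) arises here: Chebyshev's bound multiplied by L^(-ε), using x·L^(-ε) = L.
  have hLn : L / Real.log x ≤ 24 * n * L ^ (-ε) := by
    rw [div_le_iff₀ hlogx]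
    have := mul_le_mul_of_nonneg_right hcheb (Real.rpow_nonneg hL0.le (-ε))
    linarith
  -- The constant is 1544 = 16·24·4 + 8: the first part from the sum over pairs, with n·y ≤ 4c, the
  -- 8 from collisions.
  have h1 := abs_sum_quotients_le hp hj hx hxp hNp hR hT
  have h2 : 4 * L * (N + x * (1 + Real.log x)) / Real.log (x / 2) ≤
      16 * y * (24 * n * L ^ (-ε)) := by
    calc 4 * L * (N + x * (1 + Real.log x)) / Real.log (x / 2)
        ≤ 4 * L * (y + y) / (Real.log x / 2) := by
          have : x * (1 + Real.log x) ≤ y := by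
            rw [← hxy]
            exact mul_le_mul_of_nonneg_left hlog (by linarith)
          gcongr
      _ = 16 * y * (L / Real.log x) := by ring
      _ ≤ _ := by gcongr
  have h3 : 4 * (n * N) / x ≤ 8 * L ^ (-ε) * c := by
    have h4 : 1 ≤ L ^ (-ε) * x := by linarith
    rw [div_le_iff₀ (by linarith)]
    nlinarith
  have h5 : 16 * y * (24 * n * L ^ (-ε)) ≤ 1536 * L ^ (-ε) * c := by
    have := mul_le_mul_of_nonneg_right hnN (Real.rpow_nonneg hL0.le (-ε))
    linarith
  linarith

theorem eventually_abs_sum_aikpsT_le {ε : ℝ} (hε : 0 < ε) :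
    ∀ᶠ p : ℕ in atTop, p.Prime →
      Real.log p ^ (1 + ε) < p ∧ (aikpsT ε p).Nonempty ∧ ∀ j : ℕ, ¬ p ∣ j →
        |∑ t ∈ aikpsT ε p, Real.cos (j * (2 * Real.pi * t / p))| ≤
          1544 * Real.log p ^ (-ε) * (aikpsT ε p).card := by
  have hL : Tendsto (fun p : ℕ => Real.log p) atTop atTop :=
    Real.tendsto_log_atTop.comp tendsto_natCast_atTop_atTop
  have hx : Tendsto (fun p : ℕ => Real.log p ^ (1 + ε)) atTop atTop :=
    (tendsto_rpow_atTop (by linarith)).comp hL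
  have hlog : ∀ᶠ L : ℝ in atTop, 1 + Real.log (L ^ (1 + ε)) ≤ L ^ ε := by
    -- This constant makes (1+ε) log L at most L^ε/2; the other half exceeds 1 once L^ε ≥ 2.
    have h1 := (isLittleO_log_rpow_atTop hε).bound (show (0 : ℝ) < 1 / (2 * (1 + ε)) by positivity)
    filter_upwards [h1, eventually_ge_atTop 1, (tendsto_rpow_atTop hε).eventually_ge_atTop 2]
      with L h hL1 h2
    have hL0 : 0 < L := by linarith
    rw [Real.norm_of_nonneg (Real.log_nonneg hL1),
      Real.norm_of_nonneg (Real.rpow_nonneg hL0.le _)] at h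
    rw [Real.log_rpow hL0]
    have h3 := mul_le_mul_of_nonneg_left h (show 0 ≤ 1 + ε by linarith)
    have h4 : (1 + ε) * (1 / (2 * (1 + ε)) * L ^ ε) = L ^ ε / 2 := by field_simp
    linarith
  have hTp : ∀ᶠ p : ℝ in atTop, Real.log p ^ (2 + 3 * ε) < p := by
    have h1 := (isLittleO_log_rpow_rpow_atTop (2 + 3 * ε) one_pos).bound
      (show (0 : ℝ) < 1 / 2 by norm_num)
    filter_upwards [h1, eventually_ge_atTop 1] with p h hp1
    rw [Real.rpow_one, Real.norm_of_nonneg (Real.rpow_nonneg (Real.log_nonneg hp1) _),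
      Real.norm_of_nonneg (by linarith)] at h
    linarith
  filter_upwards [hL.eventually_ge_atTop 1, hx.eventually_ge_atTop 4,
    hx.eventually eventually_le_card_filter_prime_mul_log, hL.eventually hlog,
    tendsto_natCast_atTop_atTop.eventually hTp] with p h1 h2 h3 h4 h5 hp
  exact abs_sum_aikpsT_le hε hp h1 h2 h3 h4 h5

theorem eventually_acceptProb_le {ε : ℝ} (hε : 0 < ε) :
    ∀ᶠ p : ℕ in atTop, p.Prime →
      Real.log p ^ (1 + ε) < p ∧ (aikpsT ε p).Nonempty ∧
        ∀ (d : ℕ) [NeZero d] (M : QFA Unit (Fin d × Fin 2)), IsAIKPSAutomaton ε p M →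
          ∀ w ∉ langL p, M.acceptProb w ≤ 1544 ^ 2 * Real.log p ^ (-(2 * ε)) := by
  filter_upwards [eventually_abs_sum_aikpsT_le hε] with p h hp
  obtain ⟨h1, h2, h3⟩ := h hp
  refine ⟨h1, h2, ?_⟩
  rintro d _ M ⟨k, hk, hM⟩ w hw
  have hw' : w = List.replicate w.length () := List.eq_replicate_iff.2 ⟨rfl, fun _ _ => rfl⟩
  have hj : ¬ p ∣ w.length := fun h => hw ⟨_, h, hw'⟩
  have h4 := h3 _ hj
  have hd : (0 : ℝ) < d := by exact_mod_cast Nat.pos_of_ne_zero (NeZero.ne d)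
  have hL : 0 ≤ Real.log p := Real.log_natCast_nonneg p
  rw [hk.card_eq, ← hk.sum_eq fun t => Real.cos (w.length * (2 * Real.pi * t / p))] at h4
  rw [hw', hM.acceptProb_replicate, show -(2 * ε) = -ε * (2 : ℕ) by push_cast; ring,
    Real.rpow_mul_natCast hL, ← mul_pow, ← sq_abs, abs_div, abs_of_pos hd]
  exact pow_le_pow_left₀ (by positivity) ((div_le_iff₀ hd).2 h4) 2
theorem mainTheorem2 :
    ∃ C : ℝ, 0 < C ∧ ∀ ε : ℝ, 0 < ε →
      (∀ p : ℕ, p.Prime → Real.log p ^ (1 + ε) < p →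
        (∀ (d : ℕ) [NeZero d] (k : Fin d → ℕ), EnumeratesT ε p k →
          ∃ M : QFA Unit (Fin d × Fin 2), IsCombined p k M) ∧
        (∀ (d : ℕ) [NeZero d] (M : QFA Unit (Fin d × Fin 2)), IsAIKPSAutomaton ε p M →
          (M.numStates : ℝ) ≤ C * Real.log p ^ (2 + 3 * ε) ∧
          ∀ w ∈ langL p, M.acceptProb w = 1)) ∧
      (∀ᶠ p : ℕ in atTop, p.Prime →
        Real.log p ^ (1 + ε) < p ∧ (aikpsT ε p).Nonempty ∧
        ∀ (d : ℕ) [NeZero d] (M : QFA Unit (Fin d × Fin 2)), IsAIKPSAutomaton ε p M →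
          ∀ w ∉ langL p, M.acceptProb w ≤ C * Real.log p ^ (-(2 * ε))) ∧
      (∀ η : ℝ, 0 < η → ∀ᶠ p : ℕ in atTop, p.Prime →
        ∀ (d : ℕ) [NeZero d] (M : QFA Unit (Fin d × Fin 2)), IsAIKPSAutomaton ε p M →
          ∀ w ∉ langL p, M.acceptProb w ≤ η) := by
  -- The square comes from amplitude to probability; the state count 2d would need only the constant
  -- 2.
  refine ⟨1544 ^ 2, by norm_num, fun ε hε => ⟨fun p hp _ => ⟨fun d _ k _ => exists_isCombined p k,
    ?_⟩, eventually_acceptProb_le hε, fun η hη => ?_⟩⟩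
  · rintro d _ M ⟨k, hk, hM⟩
    refine ⟨?_, fun w hw => hM.acceptProb_eq_one hp.ne_zero hw⟩
    have h1 := card_aikpsT_le ε hp.one_lt
    rw [hk.card_eq] at h1
    have h2 : 0 ≤ Real.log p ^ (2 + 3 * ε) := Real.rpow_nonneg (Real.log_natCast_nonneg p) _
    rw [QFA.numStates, Fintype.card_prod, Fintype.card_fin, Fintype.card_fin]
    push_cast
    linarith
  · have ht : Tendsto (fun p : ℕ => 1544 ^ 2 * Real.log p ^ (-(2 * ε))) atTop (nhds 0) := by
      have h1 := ((tendsto_rpow_neg_atTop (show 0 < 2 * ε by positivity)).comp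
        (Real.tendsto_log_atTop.comp tendsto_natCast_atTop_atTop)).const_mul (1544 ^ 2 : ℝ)
      rwa [mul_zero] at h1
    filter_upwards [eventually_acceptProb_le hε, ht.eventually_le_const hη] with p h hle hp
    intro d _ M hM w hw
    exact ((h hp).2.2 d M hM w hw).trans hle
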